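/- Let $D$ be a finite abelian group and let $q : D \to \mathbb{Q}/\mathbb{Z}$ be a non-degenerate quadratic form, i.e. $q(nx) = n^2 q(x)$ for all $n \in \mathbb{Z}$, $x \in D$, and $b(x,y) = q(x+y) - q(x) - q(y)$ is a non-degenerate bilinear form on $D$. For each integer $n \ge 1$ let $\tau_n(q) = \sum_{x \in D} e^{2\pi i n q(x)}$ be the $n$-th (higher) Gauss sum of $q$. Then $(D,q)$ is isomorphic to its negation $(D,-q)$, that is, there is a group automorphism $f$ of $D$ with $q(f(x)) = -q(x)$ for all $x \in D$, if and only if $\tau_n(q)$ is a real number for every $n \ge 1$. -/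

import Mathlib

noncomputable section

namespace FiniteQuadraticForm

/-- The standard exponential `ℚ/ℤ → ℂ`, `r + ℤ ↦ e^{2π i r}`. -/
def expQZ : AddCircle (1 : ℚ) → ℂ :=
  Function.Periodic.lift (f := fun r : ℚ => Complex.exp (2 * Real.pi * Complex.I * (r : ℂ)))
    (c := (1 : ℚ)) (by
      intro r
      simp only [Rat.cast_add, Rat.cast_one, mul_add, mul_one]
      exact Complex.exp_periodic _)

theorem expQZ_coe (r : ℚ) :
    expQZ (r : AddCircle (1 : ℚ)) = Complex.exp (2 * Real.pi * Complex.I * (r : ℂ)) := rfl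

variable {D : Type*} [AddCommGroup D]

/-- A quadratic form `q : D → ℚ/ℤ` is non-degenerate if its bilinear form
`b(x, y) = q(x + y) - q(x) - q(y)` is. -/
def Nondegenerate (q : QuadraticMap ℤ D (AddCircle (1 : ℚ))) : Prop :=
  q.polarBilin.Nondegenerate

/-- `q` is `T`-invariant if `(D, q) ≅ (D, -q)`: some group automorphism `f` of `D` satisfies
`q = (-q) ∘ f`. -/
def IsTInvariant (q : QuadraticMap ℤ D (AddCircle (1 : ℚ))) : Prop :=
  q.Equivalent (-q)

/-- The `n`-th Gauss sum `τ_n(q) = ∑_{x ∈ D} e^{2π i n q(x)}`. -/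
def gaussSum [Fintype D] (q : QuadraticMap ℤ D (AddCircle (1 : ℚ))) (n : ℕ) : ℂ :=
  ∑ x : D, expQZ (n • q x)

end FiniteQuadraticForm

end

/-! ### The character of ℚ/ℤ and Fourier inversion -/

namespace FiniteQuadraticForm

/-! If `q ∘ f = -q`, reindexing along `f` shows that each Gauss sum equals its conjugate.

For the converse, send each map `f : D → D`, viewed as a tuple in `D^D`, to the family of all values
`q (f x)` and `b (f x, f y)`. By Fourier inversion, the number of `f` with a prescribed family `v`
is a combination of exponential sums over `D^D`. If these sums are real, `v` and `-v` are attained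
equally often (`exists_eq_neg_of_isSelfAdjoint`). The identity attains its own family, so some `f`
negates both `q` and `b`, and nondegeneracy makes such an `f` an automorphism
(`isTInvariant_of_map`).

The sums in question are Gauss sums of `q` tensored with integral symmetric matrices. They are real
by `isSelfAdjoint_sum_forms`: reduce to p-groups, then diagonalise the matrix modulo a power of p.
Rank-one blocks contribute Gauss sums of multiples of `q`, real by assumption. At p = 2 there are
also even binary blocks, whose sums are always real (`isSelfAdjoint_sum_binary`). -/

theorem expQZ_add (a b : AddCircle (1 : ℚ)) : expQZ (a + b) = expQZ a * expQZ b := by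
  induction a using QuotientAddGroup.induction_on with | _ r
  induction b using QuotientAddGroup.induction_on with | _ s
  have h : ((r : AddCircle (1 : ℚ)) + (s : AddCircle (1 : ℚ))) = ((r + s : ℚ) : AddCircle (1 : ℚ)) :=
    rfl
  change expQZ ((r : AddCircle (1 : ℚ)) + (s : AddCircle (1 : ℚ))) =
    expQZ (r : AddCircle (1 : ℚ)) * expQZ (s : AddCircle (1 : ℚ))
  rw [h, expQZ_coe, expQZ_coe, expQZ_coe, ← Complex.exp_add]
  push_cast
  ring_nf

@[simp]
theorem expQZ_zero : expQZ 0 = 1 := by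
  have h := expQZ_coe 0
  simpa using h

theorem star_expQZ (a : AddCircle (1 : ℚ)) : star (expQZ a) = expQZ (-a) := by
  induction a using QuotientAddGroup.induction_on with | _ r
  change star (expQZ (r : AddCircle (1 : ℚ))) = expQZ ((-r : ℚ) : AddCircle (1 : ℚ))
  rw [expQZ_coe, expQZ_coe, Complex.star_def, ← Complex.exp_conj]
  simp [map_ofNat]

theorem expQZ_eq_one_iff (a : AddCircle (1 : ℚ)) : expQZ a = 1 ↔ a = 0 := by
  refine ⟨fun h => ?_, fun h => by simp [h]⟩
  induction a using QuotientAddGroup.induction_on with | _ r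
  change expQZ (r : AddCircle (1 : ℚ)) = 1 at h
  change (r : AddCircle (1 : ℚ)) = 0
  rw [expQZ_coe, Complex.exp_eq_one_iff] at h
  obtain ⟨n, hn⟩ := h
  rw [mul_comm] at hn
  have h2 : (r : ℂ) = n := mul_right_cancel₀ Complex.two_pi_I_ne_zero hn
  have h3 : r = n := by exact_mod_cast h2
  rw [h3, AddCircle.coe_eq_zero_iff]
  exact ⟨n, by simp⟩

theorem expQZ_sum {κ : Type*} (s : Finset κ) (f : κ → AddCircle (1 : ℚ)) :
    expQZ (∑ k ∈ s, f k) = ∏ k ∈ s, expQZ (f k) := by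
  classical
  induction s using Finset.induction_on with
  | empty => simp
  | insert a s ha ih => rw [Finset.sum_insert ha, Finset.prod_insert ha, expQZ_add, ih]

theorem expQZ_nsmul (n : ℕ) (a : AddCircle (1 : ℚ)) : expQZ (n • a) = expQZ a ^ n := by
  induction n with
  | zero => simp
  | succ n ih => rw [succ_nsmul, expQZ_add, ih, pow_succ]

theorem sum_range_expQZ {N : ℕ} {a : AddCircle (1 : ℚ)} (ha : N • a = 0) :
    ∑ n ∈ Finset.range N, expQZ (n • a) = if a = 0 then (N : ℂ) else 0 := by
  split_ifs with h
  · simp [h]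
  · simp only [expQZ_nsmul]
    have h1 : expQZ a ≠ 1 := fun h' => h ((expQZ_eq_one_iff a).1 h')
    rw [geom_sum_eq h1, ← expQZ_nsmul, ha]
    simp

/-- If all exponential sums of `Φ : X → (ℚ/ℤ)^κ` are real, then the image of `Φ` is symmetric. -/
theorem exists_eq_neg_of_isSelfAdjoint {X κ : Type*} [Fintype X] [Fintype κ] {N : ℕ} (hN : N ≠ 0)
    (Φ : X → κ → AddCircle (1 : ℚ)) (hΦ : ∀ x k, N • Φ x k = 0)
    (hreal : ∀ n : κ → ℕ, IsSelfAdjoint (∑ x, expQZ (∑ k, n k • Φ x k))) (x : X) :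
    ∃ y, Φ y = -Φ x := by
  classical
  let S : (κ → AddCircle (1 : ℚ)) → ℂ := fun v =>
    ∑ n ∈ Fintype.piFinset (fun _ : κ => Finset.range N),
      (∑ y, expQZ (∑ k, n k • Φ y k)) * expQZ (∑ k, n k • (-v k))
  have hS : ∀ v : κ → AddCircle (1 : ℚ), (∀ k, N • v k = 0) →
      S v = ∑ y, if Φ y = v then ((N : ℂ) ^ Fintype.card κ) else 0 := by
    intro v hv
    simp only [S, Finset.sum_mul]
    rw [Finset.sum_comm]
    refine Finset.sum_congr rfl fun y _ => ?_
    have h1 : ∀ n : κ → ℕ, expQZ (∑ k, n k • Φ y k) * expQZ (∑ k, n k • (-v k)) =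
        ∏ k, expQZ (n k • (Φ y k - v k)) := by
      intro n
      rw [← expQZ_add, ← expQZ_sum, ← Finset.sum_add_distrib]
      simp only [sub_eq_add_neg, smul_add]
    simp only [h1]
    rw [← Finset.prod_univ_sum (fun _ => Finset.range N) (fun k n => expQZ (n • (Φ y k - v k)))]
    have h2 : ∀ k, ∑ n ∈ Finset.range N, expQZ (n • (Φ y k - v k)) =
        if Φ y k - v k = 0 then (N : ℂ) else 0 := fun k =>
      sum_range_expQZ (by rw [smul_sub, hΦ, hv, sub_zero])
    simp only [h2]
    split_ifs with h
    · simp [h]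
    · obtain ⟨k, hk⟩ := Function.ne_iff.1 h
      exact Finset.prod_eq_zero (Finset.mem_univ k) (by simp [sub_eq_zero, hk])
  have hstar : ∀ v, star (S v) = S (-v) := by
    intro v
    simp only [S, star_sum, star_mul']
    refine Finset.sum_congr rfl fun n _ => ?_
    rw [star_expQZ, ← star_sum, (hreal n).star_eq]
    simp
  by_contra! hne
  have h0 : S (-Φ x) = 0 := by
    rw [hS _ (fun k => by simp [hΦ])]
    exact Finset.sum_eq_zero fun y _ => if_neg (hne y)
  have h1 : S (Φ x) = 0 := by
    have := hstar (-Φ x)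
    rw [neg_neg, h0, star_zero] at this
    exact this.symm
  rw [hS _ (hΦ x), ← Finset.sum_filter, Finset.sum_const] at h1
  have h2 : (Finset.univ.filter fun y => Φ y = Φ x).card ≠ 0 :=
    Finset.card_ne_zero_of_mem (Finset.mem_filter.2 ⟨Finset.mem_univ x, rfl⟩)
  simp [hN] at h1
  exact h1 rfl

/-! ### Tensor products of `q` with integral forms -/

section Forms

variable {D : Type*} [AddCommGroup D] (q : QuadraticMap ℤ D (AddCircle (1 : ℚ)))

theorem map_add_polarBilin (x y : D) : q (x + y) = q x + q y + q.polarBilin x y := by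
  simpa using QuadraticMap.map_add q x y

theorem polarBilin_comm (x y : D) : q.polarBilin x y = q.polarBilin y x := by
  simpa using QuadraticMap.polar_comm q x y

theorem polarBilin_self (x : D) : q.polarBilin x x = (2 : ℤ) • q x := by
  rw [QuadraticMap.polarBilin_apply_apply, QuadraticMap.polar_self, ofNat_zsmul]

variable {ι : Type*} [Fintype ι]

/-- The linear combination `y ↦ ∑ l, c l • y l`. -/
def linComb (c : ι → ℤ) (y : ι → D) : D := ∑ l, c l • y l


theorem linComb_add (c : ι → ℤ) (x y : ι → D) :
    linComb c (x + y) = linComb c x + linComb c y := by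
  simp [linComb, Finset.sum_add_distrib]

theorem polarBilin_linComb (c c' : ι → ℤ) (x y : ι → D) :
    q.polarBilin (linComb c x) (linComb c' y) =
      ∑ i, ∑ j, (c i * c' j) • q.polarBilin (x i) (y j) := by
  simp only [linComb, map_sum, LinearMap.sum_apply, map_smul, LinearMap.smul_apply,
    Finset.smul_sum, smul_smul]
  rw [Finset.sum_comm]
  simp only [mul_comm]

variable (ι) [DecidableEq ι]

/-- The functions on `D^ι` obtained by tensoring `q` with integral quadratic forms on `ℤ^ι`,
described by the matrix `A` of their bilinear form. -/
def forms : AddSubgroup ((ι → D) → AddCircle (1 : ℚ)) where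
  carrier := {G | ∃ A : ι → ι → ℤ,
    (∀ x y, G (x + y) = G x + G y + ∑ i, ∑ j, A i j • q.polarBilin (x i) (y j)) ∧
    ∀ i z, G (Pi.single i z) = A i i • q z}
  zero_mem' := ⟨0, by simp, by simp⟩
  add_mem' := by
    rintro G G' ⟨A, h1, h2⟩ ⟨A', h1', h2'⟩
    refine ⟨A + A', fun x y => ?_, fun i z => ?_⟩
    · simp only [Pi.add_apply, h1, h1', add_smul, Finset.sum_add_distrib]
      abel
    · simp only [Pi.add_apply, h2, h2', add_smul]
  neg_mem' := by
    rintro G ⟨A, h1, h2⟩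
    refine ⟨-A, fun x y => ?_, fun i z => ?_⟩
    · simp only [Pi.neg_apply, h1, neg_smul, Finset.sum_neg_distrib]
      abel
    · simp only [Pi.neg_apply, h2, neg_smul]

variable {ι}

theorem linComb_single (c : ι → ℤ) (i : ι) (z : D) : linComb c (Pi.single i z) = c i • z := by
  rw [linComb, Finset.sum_eq_single i] <;> simp +contextual

theorem smul_map_linComb_mem_forms (n : ℤ) (c : ι → ℤ) :
    (fun y : ι → D => n • q (linComb c y)) ∈ forms q ι := by
  refine ⟨fun i j => n * (c i * c j), fun x y => ?_, fun i z => ?_⟩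
  · simp only [linComb_add, map_add_polarBilin, polarBilin_linComb, smul_add, Finset.smul_sum,
      smul_smul]
  · simp only [linComb_single, QuadraticMap.map_smul, smul_smul]

theorem smul_polarBilin_linComb_mem_forms (n : ℤ) (c c' : ι → ℤ) :
    (fun y : ι → D => n • q.polarBilin (linComb c y) (linComb c' y)) ∈ forms q ι := by
  refine ⟨fun i j => n * (c i * c' j + c' i * c j), fun x y => ?_, fun i z => ?_⟩
  · simp only [linComb_add, map_add, LinearMap.add_apply, smul_add, mul_add, add_smul,
      Finset.sum_add_distrib, ← smul_smul n, ← Finset.smul_sum, ← polarBilin_linComb]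
    rw [polarBilin_comm q (linComb c y)]
    abel
  · simp only [linComb_single, map_smul, LinearMap.smul_apply, polarBilin_self, smul_smul]
    congr 1
    ring

end Forms

end FiniteQuadraticForm

noncomputable section

namespace FiniteQuadraticForm

/-! ### Arithmetic modulo prime powers -/

section Arithmetic

/-- Hensel's lemma: `t = 0` is a root modulo 2, and the derivative `2 * P * t + b` is odd. The root
will give a 2 × 2 matrix of determinant -1. -/
theorem exists_two_pow_dvd_quadratic (P b : ℤ) (hb : Odd b) (K : ℕ) :
    ∃ t : ℤ, (2 : ℤ) ^ K ∣ P * t ^ 2 + b * t + 2 := by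
  obtain ⟨k, rfl⟩ := hb
  suffices h : ∃ t : ℤ, (2 : ℤ) ^ (K + 1) ∣ P * t ^ 2 + (2 * k + 1) * t + 2 by
    obtain ⟨t, ht⟩ := h
    exact ⟨t, (pow_dvd_pow 2 (Nat.le_succ K)).trans ht⟩
  induction K with
  | zero => exact ⟨0, by norm_num⟩
  | succ K ih =>
    obtain ⟨t, r, hr⟩ := ih
    -- Newton step: modulo 2 the inverse of minus the derivative is 1, so the correction is the
    -- quotient `r` itself.
    refine ⟨t + 2 ^ (K + 1) * r, r * (1 + k + P * t) + P * 2 ^ K * r ^ 2, ?_⟩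
    have h : P * (t + 2 ^ (K + 1) * r) ^ 2 + (2 * k + 1) * (t + 2 ^ (K + 1) * r) + 2 =
        (P * t ^ 2 + (2 * k + 1) * t + 2) +
          2 ^ (K + 1) * r * (2 * P * t + (2 * k + 1)) + P * (2 ^ (K + 1)) ^ 2 * r ^ 2 := by ring
    rw [h, hr]
    ring

theorem exists_pow_dvd_or_exists_factor {ι : Type*} (p K : ℕ) (s : Finset ι) (A : ι → ι → ℤ) :
    (∀ i ∈ s, ∀ j ∈ s, (p : ℤ) ^ K ∣ A i j) ∨
      ∃ (v : ℕ) (A' : ι → ι → ℤ), (∀ i ∈ s, ∀ j ∈ s, A i j = (p : ℤ) ^ v * A' i j) ∧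
        ∃ i ∈ s, ∃ j ∈ s, ¬ (p : ℤ) ∣ A' i j := by
  induction K with
  | zero => exact Or.inl (by simp)
  | succ K ih =>
    rcases ih with h | h
    · by_cases hall : ∀ i ∈ s, ∀ j ∈ s, (p : ℤ) ^ (K + 1) ∣ A i j
      · exact Or.inl hall
      · right
        push Not at hall
        obtain ⟨i, hi, j, hj, hij⟩ := hall
        choose! A' hA' using h
        refine ⟨K, A', hA', i, hi, j, hj, ?_⟩
        rintro ⟨c, hc⟩
        exact hij ⟨c, by rw [hA' i hi j hj, hc]; ring⟩
    · exact Or.inr h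

end Arithmetic

/-! ### Splitting an exponential sum by completing the square -/

section Split

variable {D : Type*} [AddCommGroup D] [Fintype D] {ι : Type*} [Fintype ι]

open scoped Classical in
/-- The tuples in `D^ι` supported on `s`. -/
def supported (D : Type*) [AddCommGroup D] [Fintype D] (s : Finset ι) : Finset (ι → D) :=
  Finset.univ.filter fun x => ∀ l, l ∉ s → x l = 0

theorem mem_supported {s : Finset ι} {x : ι → D} :
    x ∈ supported D s ↔ ∀ l, l ∉ s → x l = 0 := by
  simp [supported]

/-- Write `x = emb z + y`; once the square is completed, the shift of `z` by `u y` does not change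
the sum over `z`, so the two variables separate. -/
theorem sum_supported_eq_mul {E : Type*} [AddCommGroup E] [Fintype E] {s s' : Finset ι}
    (hs : s' ⊆ s) (emb : E → ι → D) (pr : (ι → D) →+ E) (hpr : ∀ z, pr (emb z) = z)
    (hpr' : ∀ y ∈ supported D s', pr y = 0) (hemb : ∀ z, emb z ∈ supported D s)
    (hsub : ∀ x ∈ supported D s, x - emb (pr x) ∈ supported D s')
    (G G' : (ι → D) → AddCircle (1 : ℚ)) (H : E → AddCircle (1 : ℚ)) (u : (ι → D) → E)
    (hG : ∀ z, ∀ y ∈ supported D s', G (emb z + y) = H (z + u y) + G' y) :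
    ∑ x ∈ supported D s, expQZ (G x) =
      (∑ z, expQZ (H z)) * ∑ y ∈ supported D s', expQZ (G' y) := by
  classical
  have h1 : ∑ x ∈ supported D s, expQZ (G x) =
      ∑ w ∈ Finset.univ ×ˢ supported D s', expQZ (G (emb w.1 + w.2)) := by
    refine Finset.sum_bij' (fun x _ => (pr x, x - emb (pr x))) (fun w _ => emb w.1 + w.2)
      ?_ ?_ ?_ ?_ ?_
    · intro x hx
      simpa using hsub x hx
    · intro w hw
      rw [Finset.mem_product] at hw
      have h2 := mem_supported.1 (hemb w.1)
      have h3 := mem_supported.1 hw.2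
      exact mem_supported.2 fun l hl => by
        rw [Pi.add_apply, h2 l hl, h3 l fun h => hl (hs h), add_zero]
    · intro x _
      simp
    · intro w hw
      rw [Finset.mem_product] at hw
      have : pr (emb w.1 + w.2) = w.1 := by rw [map_add, hpr, hpr' _ hw.2, add_zero]
      ext1
      · exact this
      · simp [this]
    · intro x _
      simp
  rw [h1, Finset.sum_product_right, Finset.mul_sum]
  refine Finset.sum_congr rfl fun y hy => ?_
  rw [← Equiv.sum_comp (Equiv.addRight (u y)) fun z => expQZ (H z), Finset.sum_mul]
  refine Finset.sum_congr rfl fun z _ => ?_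
  dsimp only
  rw [hG z y hy, expQZ_add]
  rfl

end Split

/-! ### Diagonalisation over p-groups -/

section PrimePower

variable {D : Type*} [AddCommGroup D] (q : QuadraticMap ℤ D (AddCircle (1 : ℚ)))
  {ι : Type*} [Fintype ι]

theorem smul_polarBilin_eq_of_modEq {N : ℤ} (hN : ∀ x : D, N • x = 0) {m n : ℤ}
    (h : N ∣ m - n) (x y : D) : m • q.polarBilin x y = n • q.polarBilin x y := by
  obtain ⟨t, ht⟩ := h
  rw [← sub_eq_zero, ← sub_smul, ht, mul_comm, mul_smul, ← map_smul, hN, map_zero, smul_zero]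

theorem linComb_eq_of_modEq {N : ℤ} (hN : ∀ x : D, N • x = 0) {c c' : ι → ℤ}
    (h : ∀ l, N ∣ c l - c' l) (y : ι → D) : linComb c y = linComb c' y := by
  refine Finset.sum_congr rfl fun l _ => ?_
  obtain ⟨t, ht⟩ := h l
  rw [← sub_eq_zero, ← sub_smul, ht, mul_smul, hN]

theorem smul_linComb_add (a b : ℤ) (c c' : ι → ℤ) (y : ι → D) :
    a • linComb c y + b • linComb c' y = linComb (fun l => a * c l + b * c' l) y := by
  simp only [linComb, Finset.smul_sum, smul_smul, ← Finset.sum_add_distrib, add_smul]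

theorem smul_polarBilin_linComb (n : ℤ) (c : ι → ℤ) (z : D) (y : ι → D) :
    n • q.polarBilin z (linComb c y) = ∑ l, (n * c l) • q.polarBilin z (y l) := by
  simp only [linComb, map_sum, map_smul, Finset.smul_sum, smul_smul]

theorem sum_sum_single [DecidableEq ι] (A : ι → ι → ℤ) (i : ι) (z : D) (y : ι → D) :
    ∑ k, ∑ l, A k l • q.polarBilin ((Pi.single i z : ι → D) k) (y l) =
      ∑ l, A i l • q.polarBilin z (y l) := by
  rw [Finset.sum_eq_single i]
  · simp
  · intro k _ hk
    simp [Pi.single_eq_of_ne hk]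
  · simp

theorem sum_single [DecidableEq ι] (A : ι → ℤ) (i : ι) (z w : D) :
    ∑ l, A l • q.polarBilin z ((Pi.single i w : ι → D) l) = A i • q.polarBilin z w := by
  rw [Finset.sum_eq_single i]
  · simp
  · intro k _ hk
    simp [Pi.single_eq_of_ne hk]
  · simp

variable [Fintype D]

/-- The binary forms `a x² + b x y + c y²` with `b` odd have real Gauss sums on `2`-groups: they
admit similitudes of multiplier `-1` modulo powers of `2`. -/
theorem isSelfAdjoint_sum_binary {K : ℕ} (hK : ∀ x : D, (2 : ℤ) ^ K • x = 0)
    (n a b c : ℤ) (hb : Odd b) :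
    IsSelfAdjoint (∑ w : D × D, expQZ (n • (a • q.polarBilin w.1 w.1 + b • q.polarBilin w.1 w.2 +
      c • q.polarBilin w.2 w.2))) := by
  obtain ⟨t, ht⟩ := exists_two_pow_dvd_quadratic (a * c) b hb K
  -- Multiplication by `1 + t * ω` for an `ω` of trace `b` and norm `a * c`. It scales the binary
  -- form by its determinant `a * c * t ^ 2 + b * t + 1`, which is -1 modulo `2 ^ K`.
  let φ : D × D → D × D := fun w =>
    (w.1 - (t * c) • w.2, (1 + t * b) • w.2 + (t * a) • w.1)
  -- Minus the adjugate of `φ`, hence its inverse when the determinant is -1.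
  let ψ : D × D → D × D := fun w =>
    (-((1 + t * b) • w.1 + (t * c) • w.2), -(w.2 - (t * a) • w.1))
  have hkill : ∀ x : D, (a * c * t ^ 2 + b * t + 2) • x = 0 := by
    obtain ⟨r, hr⟩ := ht
    intro x
    rw [hr, mul_smul, hK]
  have hψφ : ∀ w, ψ (φ w) = w := by
    rintro ⟨x, y⟩
    have e1 : (ψ (φ (x, y))).1 = x - (a * c * t ^ 2 + b * t + 2) • x := by
      simp only [φ, ψ]
      module
    have e2 : (ψ (φ (x, y))).2 = y - (a * c * t ^ 2 + b * t + 2) • y := by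
      simp only [φ, ψ]
      module
    rw [hkill, sub_zero] at e1 e2
    exact Prod.ext e1 e2
  have hφ : Function.Bijective φ :=
    (Function.LeftInverse.injective hψφ).bijective_of_finite
  let H : D × D → AddCircle (1 : ℚ) := fun w =>
    n • (a • q.polarBilin w.1 w.1 + b • q.polarBilin w.1 w.2 + c • q.polarBilin w.2 w.2)
  have hH : ∀ w, H (φ w) = -H w := by
    rintro ⟨x, y⟩
    have hB : ∀ x y : D, (a * c * t ^ 2 + b * t + 2) • q.polarBilin x y = 0 := fun x y => by
      rw [← map_smul, hkill, map_zero]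
    have e : H (φ (x, y)) = -H (x, y) +
        n • (a • ((a * c * t ^ 2 + b * t + 2) • q.polarBilin x x) +
          b • ((a * c * t ^ 2 + b * t + 2) • q.polarBilin x y) +
          c • ((a * c * t ^ 2 + b * t + 2) • q.polarBilin y y)) := by
      simp only [H, φ, map_add, map_sub, map_smul, LinearMap.add_apply, LinearMap.sub_apply,
        LinearMap.smul_apply, polarBilin_comm q y x]
      module
    rw [e, hB, hB, hB]
    simp
  change star (∑ w, expQZ (H w)) = ∑ w, expQZ (H w)
  rw [star_sum, ← (Equiv.ofBijective φ hφ).sum_comp fun w => expQZ (H w)]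
  refine Finset.sum_congr rfl fun w _ => ?_
  rw [star_expQZ, Equiv.ofBijective_apply, hH]

variable [DecidableEq ι]

/-- Splitting off the line spanned by the integral vector `a`. -/
theorem sum_supported_eq_mul_of_vector {s : Finset ι} {i : ι} (hi : i ∈ s)
    {G : (ι → D) → AddCircle (1 : ℚ)} (hGmem : G ∈ forms q ι) {A : ι → ι → ℤ}
    (hA : ∀ x y, G (x + y) = G x + G y + ∑ i, ∑ j, A i j • q.polarBilin (x i) (y j))
    (a : ι → ℤ) (hai : a i = 1) (has : ∀ l, l ∉ s → a l = 0) (α : ℤ)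
    (hα : ∀ z, G (fun l => a l • z) = α • q z) (c : ι → ℤ)
    (hc : ∀ l ∈ s, ∀ z w : D, (∑ k, a k * A k l) • q.polarBilin z w =
      (α * c l) • q.polarBilin z w) :
    ∃ G' ∈ forms q ι, ∑ x ∈ supported D s, expQZ (G x) =
      (∑ z, expQZ (α • q z)) * ∑ y ∈ supported D (s.erase i), expQZ (G' y) := by
  -- The complement is `G` minus `α • q (linComb c y)`. Only cross terms in `b` need matching, so
  -- `c` matters only modulo the exponent of `D`; `q` itself need not be killed by that exponent.
  refine ⟨_, sub_mem hGmem (smul_map_linComb_mem_forms q α c),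
    sum_supported_eq_mul (Finset.erase_subset i s) (fun z l => a l • z)
      (Pi.evalAddMonoidHom (fun _ => D) i) (fun z => by simp [hai]) (fun y hy => ?_)
      (fun z => mem_supported.2 fun l hl => by simp [has l hl]) (fun x hx => ?_)
      G _ (fun z => α • q z) (linComb c) (fun z y hy => ?_)⟩
  · exact mem_supported.1 hy i (by simp)
  · refine mem_supported.2 fun l hl => ?_
    rcases eq_or_ne l i with rfl | hli
    · simp [hai]
    · have hls : l ∉ s := fun h => hl (Finset.mem_erase.2 ⟨hli, h⟩)
      simp [has l hls, mem_supported.1 hx l hls]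
  · have h1 : ∑ k, ∑ l, A k l • q.polarBilin (a k • z) (y l) =
        α • q.polarBilin z (linComb c y) := by
      rw [smul_polarBilin_linComb, Finset.sum_comm]
      refine Finset.sum_congr rfl fun l _ => ?_
      by_cases hl : l ∈ s
      · rw [← hc l hl, Finset.sum_smul]
        refine Finset.sum_congr rfl fun k _ => ?_
        rw [map_smul, LinearMap.smul_apply, smul_smul, mul_comm]
      · have : y l = 0 := mem_supported.1 hy l fun h => hl (Finset.mem_of_mem_erase h)
        simp [this]
    rw [hA, hα, h1, map_add_polarBilin, smul_add, smul_add, Pi.sub_apply]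
    abel

/-- Splitting off a line whose value has minimal valuation. -/
theorem sum_supported_eq_mul_of_not_dvd {p K : ℕ} (hp : p.Prime)
    (hK : ∀ x : D, (p : ℤ) ^ K • x = 0) {s : Finset ι} {i : ι} (hi : i ∈ s)
    {G : (ι → D) → AddCircle (1 : ℚ)} (hGmem : G ∈ forms q ι) {A : ι → ι → ℤ}
    (hA : ∀ x y, G (x + y) = G x + G y + ∑ i, ∑ j, A i j • q.polarBilin (x i) (y j))
    (a : ι → ℤ) (hai : a i = 1) (has : ∀ l, l ∉ s → a l = 0) (v : ℕ) (α : ℤ)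
    (hpα : ¬ (p : ℤ) ∣ α)
    (hα : ∀ z, G (fun l => a l • z) = ((p : ℤ) ^ v * α) • q z) (w : ι → ℤ)
    (hw : ∀ l ∈ s, ∑ k, a k * A k l = (p : ℤ) ^ v * w l) :
    ∃ G' ∈ forms q ι, ∑ x ∈ supported D s, expQZ (G x) =
      (∑ z, expQZ (((p : ℤ) ^ v * α) • q z)) *
        ∑ y ∈ supported D (s.erase i), expQZ (G' y) := by
  have hcop : IsCoprime α ((p : ℤ) ^ K) :=
    ((Nat.prime_iff_prime_int.1 hp).coprime_iff_not_dvd.2 hpα).symm.pow_right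
  obtain ⟨r, t, hrt⟩ := hcop
  refine sum_supported_eq_mul_of_vector q hi hGmem hA a hai has _ hα (fun l => r * w l) ?_
  intro l hl z y
  refine smul_polarBilin_eq_of_modEq q hK ⟨p ^ v * w l * t, ?_⟩ z y
  rw [hw l hl]
  linear_combination (-(p : ℤ) ^ v * w l) * hrt

/-- Splitting off an even binary form of minimal valuation at the prime `2`. -/
theorem sum_supported_eq_mul_of_binary {K : ℕ}
    (hK : ∀ x : D, (2 : ℤ) ^ K • x = 0) {s : Finset ι} {i j : ι} (hi : i ∈ s) (hj : j ∈ s)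
    (hij : i ≠ j) {G : (ι → D) → AddCircle (1 : ℚ)} (hGmem : G ∈ forms q ι) {A : ι → ι → ℤ}
    (hA : ∀ x y, G (x + y) = G x + G y + ∑ i, ∑ j, A i j • q.polarBilin (x i) (y j))
    (hA' : ∀ i z, G (Pi.single i z) = A i i • q z)
    (n a b c : ℤ) (hb : Odd b) (hii : A i i = n * (2 * a)) (hjj : A j j = n * (2 * c))
    (hbij : A i j = n * b) (σ σ' : ι → ℤ)
    (hσ : ∀ l ∈ s, A i l = n * σ l) (hσ' : ∀ l ∈ s, A j l = n * σ' l) :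
    ∃ G' ∈ forms q ι, ∑ x ∈ supported D s, expQZ (G x) =
      (∑ w : D × D, expQZ (n • (a • q.polarBilin w.1 w.1 + b • q.polarBilin w.1 w.2 +
        c • q.polarBilin w.2 w.2))) *
        ∑ y ∈ supported D ((s.erase i).erase j), expQZ (G' y) := by
  have hcop : IsCoprime (4 * a * c - b ^ 2) ((2 : ℤ) ^ K) := by
    refine IsCoprime.pow_right ?_
    obtain ⟨k, rfl⟩ := hb
    exact ⟨-1, 2 * a * c - 2 * k ^ 2 - 2 * k, by ring⟩
  obtain ⟨δ, t, hδ⟩ := hcop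
  -- Cramer's rule for the block with rows `(2a, b)` and `(b, 2c)`; `δ` inverts its odd determinant
  -- modulo `2 ^ K`.
  let c₁ : ι → ℤ := fun l => δ * (2 * c * σ l - b * σ' l)
  let c₂ : ι → ℤ := fun l => δ * (2 * a * σ' l - b * σ l)
  have hu1 : ∀ y : ι → D, (2 * a) • linComb c₁ y + b • linComb c₂ y = linComb σ y := fun y => by
    rw [smul_linComb_add]
    refine linComb_eq_of_modEq hK (fun l => ⟨-t * σ l, ?_⟩) y
    simp only [c₁, c₂]
    linear_combination σ l * hδ
  have hu2 : ∀ y : ι → D, b • linComb c₁ y + (2 * c) • linComb c₂ y = linComb σ' y := fun y => by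
    rw [smul_linComb_add]
    refine linComb_eq_of_modEq hK (fun l => ⟨-t * σ' l, ?_⟩) y
    simp only [c₁, c₂]
    linear_combination σ' l * hδ
  have hmem : (fun y : ι → D => (n * a) • q.polarBilin (linComb c₁ y) (linComb c₁ y)) +
      (fun y : ι → D => (n * b) • q.polarBilin (linComb c₁ y) (linComb c₂ y)) +
      (fun y : ι → D => (n * c) • q.polarBilin (linComb c₂ y) (linComb c₂ y)) ∈ forms q ι :=
    add_mem (add_mem (smul_polarBilin_linComb_mem_forms q _ _ _)
      (smul_polarBilin_linComb_mem_forms q _ _ _)) (smul_polarBilin_linComb_mem_forms q _ _ _)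
  refine ⟨_, sub_mem hGmem hmem,
    sum_supported_eq_mul ((Finset.erase_subset j _).trans (Finset.erase_subset i s))
      (fun w : D × D => Pi.single i w.1 + Pi.single j w.2)
      ((Pi.evalAddMonoidHom (fun _ => D) i).prod (Pi.evalAddMonoidHom (fun _ => D) j))
      (fun w => ?_) (fun y hy => ?_) (fun w => mem_supported.2 fun l hl => ?_)
      (fun x hx => mem_supported.2 fun l hl => ?_) G _
      (fun w => n • (a • q.polarBilin w.1 w.1 + b • q.polarBilin w.1 w.2 +
        c • q.polarBilin w.2 w.2)) (fun y => (linComb c₁ y, linComb c₂ y)) (fun w y hy => ?_)⟩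
  · ext <;> simp [hij, hij.symm]
  · have h := mem_supported.1 hy
    exact Prod.ext (h i (by simp)) (h j (by simp))
  · have h1 : l ≠ i := fun h => hl (h ▸ hi)
    have h2 : l ≠ j := fun h => hl (h ▸ hj)
    simp [h1, h2]
  · by_cases h1 : l = i
    · subst h1
      simp [hij]
    by_cases h2 : l = j
    · subst h2
      simp [hij.symm]
    have hls : l ∉ s := fun h => hl (by simp [h, h1, h2])
    simp [h1, h2, mem_supported.1 hx l hls]
  · have hcross : ∀ (k : ι) (τ : ι → ℤ), (∀ l ∈ s, A k l = n * τ l) → ∀ z : D,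
        ∑ l, A k l • q.polarBilin z (y l) = n • q.polarBilin z (linComb τ y) := by
      intro k τ hτ z
      rw [smul_polarBilin_linComb]
      refine Finset.sum_congr rfl fun l _ => ?_
      by_cases hl : l ∈ s
      · rw [hτ l hl]
      · have : y l = 0 := mem_supported.1 hy l fun h =>
          hl (Finset.mem_of_mem_erase (Finset.mem_of_mem_erase h))
        simp [this]
    obtain ⟨z, w⟩ := w
    have h1 : G (Pi.single i z + Pi.single j w + y) = A i i • q z + A j j • q w +
        A i j • q.polarBilin z w + G y + n • q.polarBilin z (linComb σ y) +
        n • q.polarBilin w (linComb σ' y) := by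
      rw [hA, hA, hA', hA', sum_sum_single, sum_single, ← hcross i σ hσ, ← hcross j σ' hσ',
        ← sum_sum_single q A i z y, ← sum_sum_single q A j w y]
      simp only [Pi.add_apply, map_add, LinearMap.add_apply, smul_add, Finset.sum_add_distrib]
      abel
    have hz : (2 : ℤ) • q z = q.polarBilin z z := (polarBilin_self q z).symm
    have hw : (2 : ℤ) • q w = q.polarBilin w w := (polarBilin_self q w).symm
    rw [h1, ← hu1, ← hu2, hii, hjj, hbij, mul_comm 2 a, mul_comm 2 c, mul_smul n, mul_smul n,
      mul_smul a, mul_smul c, hz, hw]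
    simp only [Pi.sub_apply, Pi.add_apply, Prod.mk_add_mk, map_add, map_smul, LinearMap.add_apply,
      polarBilin_comm q (linComb c₁ y) z, polarBilin_comm q (linComb c₁ y) w,
      polarBilin_comm q (linComb c₂ y) w]
    module

/-- Jordan decomposition by induction on the support: split off a line, or at p = 2 possibly a
plane, on which the matrix has minimal valuation. -/
theorem isSelfAdjoint_sum_supported {p K : ℕ} (hp : p.Prime)
    (hK : ∀ x : D, (p : ℤ) ^ K • x = 0)
    (hτ : ∀ n : ℤ, IsSelfAdjoint (∑ z, expQZ (n • q z))) (s : Finset ι) :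
    ∀ G ∈ forms q ι, IsSelfAdjoint (∑ x ∈ supported D s, expQZ (G x)) := by
  induction s using Finset.strongInduction with | H s ih
  intro G hGmem
  obtain ⟨A, hA, hA'⟩ := hGmem
  have hGmem : G ∈ forms q ι := ⟨A, hA, hA'⟩
  have hsingle : ∀ i (z : D), (fun l => (Pi.single i 1 : ι → ℤ) l • z) = Pi.single i z := by
    intro i z
    ext l
    rcases eq_or_ne l i with rfl | h <;> simp [*]
  rcases exists_pow_dvd_or_exists_factor p K s A with hdvd | ⟨v, A', hv, i, hi, j, hj, hdvd⟩
  -- Here all cross terms vanish, but `A i i • q z` need not, so each coordinate still contributes a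
  -- Gauss sum.
  · rcases s.eq_empty_or_nonempty with rfl | ⟨i, hi⟩
    · have hsupp : supported D (∅ : Finset ι) = {0} := by
        ext x
        simp [mem_supported, funext_iff]
      have hG0 : G 0 = 0 := by
        have := hA 0 0
        simpa using this
      rw [hsupp, Finset.sum_singleton, hG0, expQZ_zero]
      exact IsSelfAdjoint.one ℂ
    · obtain ⟨G', hG', h⟩ := sum_supported_eq_mul_of_vector q hi hGmem hA (Pi.single i 1)
        (by simp) (fun l hl => Pi.single_eq_of_ne (ne_of_mem_of_not_mem hi hl).symm _) (A i i)
        (fun z => by rw [hsingle, hA']) 0 (fun l hl z w => by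
          refine smul_polarBilin_eq_of_modEq q hK ?_ z w
          simpa [Pi.single_apply] using hdvd i hi l hl)
      rw [h]
      exact (hτ _).mul (ih _ (Finset.erase_ssubset hi) G' hG')
  by_cases hdiag : ∃ i ∈ s, ¬ (p : ℤ) ∣ A' i i
  · obtain ⟨i, hi, hii⟩ := hdiag
    obtain ⟨G', hG', h⟩ := sum_supported_eq_mul_of_not_dvd q hp hK hi hGmem hA (Pi.single i 1)
      (by simp) (fun l hl => Pi.single_eq_of_ne (ne_of_mem_of_not_mem hi hl).symm _) v (A' i i) hii
      (fun z => by rw [hsingle, hA', hv i hi i hi]) (A' i) (fun l hl => by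
        simpa [Pi.single_apply] using hv i hi l hl)
    rw [h]
    exact (hτ _).mul (ih _ (Finset.erase_ssubset hi) G' hG')
  push Not at hdiag
  have hij : i ≠ j := by
    rintro rfl
    exact hdvd (hdiag i hi)
  rcases hp.eq_two_or_odd' with rfl | hodd
  · obtain ⟨a, ha⟩ := hdiag i hi
    obtain ⟨c, hc⟩ := hdiag j hj
    push_cast at *
    obtain ⟨G', hG', h⟩ := sum_supported_eq_mul_of_binary q hK hi hj hij hGmem hA hA' (2 ^ v) a
      (A' i j) c (Int.not_even_iff_odd.1 fun h => hdvd h.two_dvd)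
      (by rw [hv i hi i hi, ha]) (by rw [hv j hj j hj, hc]) (hv i hi j hj) (A' i) (A' j)
      (hv i hi) (hv j hj)
    rw [h]
    refine (isSelfAdjoint_sum_binary q hK _ _ _ _
      (Int.not_even_iff_odd.1 fun h => hdvd h.two_dvd)).mul (ih _ ?_ G' hG')
    exact lt_of_le_of_lt (Finset.erase_subset _ _) (Finset.erase_ssubset hi)
  · have h2 : ¬ (p : ℤ) ∣ 2 := by
      intro h
      have h3 : p ∣ 2 := by exact_mod_cast h
      have := (Nat.prime_dvd_prime_iff_eq hp Nat.prime_two).1 h3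
      subst this
      exact absurd hodd (by decide)
    -- For odd p with only an off-diagonal unit, the vector `e_i + e_j` has a unit value.
    have hα : ¬ (p : ℤ) ∣ A' i i + A' j j + 2 * A' i j := by
      rw [Int.dvd_add_right (dvd_add (hdiag i hi) (hdiag j hj)),
        (Nat.prime_iff_prime_int.1 hp).dvd_mul]
      exact not_or.2 ⟨h2, hdvd⟩
    obtain ⟨G', hG', h⟩ := sum_supported_eq_mul_of_not_dvd q hp hK hi hGmem hA
      (Pi.single i 1 + Pi.single j 1) (by simp [hij])
      (fun l hl => by
        have h1 : l ≠ i := fun h => hl (h ▸ hi)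
        have h2 : l ≠ j := fun h => hl (h ▸ hj)
        simp [h1, h2]) v _ hα
      (fun z => by
        have : (fun l => (Pi.single i 1 + Pi.single j 1 : ι → ℤ) l • z) =
            Pi.single i z + Pi.single j z := by
          rw [← hsingle i z, ← hsingle j z]
          ext l
          simp [add_smul]
        rw [this, hA, hA', hA', sum_sum_single, sum_single, polarBilin_self, hv i hi i hi,
          hv j hj j hj, hv i hi j hj]
        module) (fun l => A' i l + A' j l) (fun l hl => by
        simp [Pi.single_apply, add_mul, Finset.sum_add_distrib, hv i hi l hl, hv j hj l hl,
          mul_add])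
    rw [h]
    exact (hτ _).mul (ih _ (Finset.erase_ssubset hi) G' hG')

end PrimePower

end FiniteQuadraticForm

end

namespace FiniteQuadraticForm

/-! ### From prime powers to general finite groups -/

theorem sum_expQZ_eq_mul {X X₁ X₂ : Type*} [Fintype X] [Fintype X₁] [Fintype X₂]
    (f : X₁ × X₂ ≃ X) (G : X → AddCircle (1 : ℚ)) (G₁ : X₁ → AddCircle (1 : ℚ))
    (G₂ : X₂ → AddCircle (1 : ℚ)) (h : ∀ w, G (f w) = G₁ w.1 + G₂ w.2) :
    ∑ x, expQZ (G x) = (∑ x, expQZ (G₁ x)) * ∑ x, expQZ (G₂ x) := by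
  rw [← f.sum_comp, Fintype.sum_mul_sum, Fintype.sum_prod_type]
  simp only [h, expQZ_add]

section

variable {D : Type*} [AddCommGroup D] (q : QuadraticMap ℤ D (AddCircle (1 : ℚ)))

theorem sq_smul_eq_zero {N : ℤ} {x : D} (h : N • x = 0) : (N ^ 2) • q x = 0 := by
  rw [sq, ← QuadraticMap.map_smul, h, QuadraticMap.map_zero]

theorem polarBilin_eq_zero_of_isCoprime {m n : ℤ} (hmn : IsCoprime m n) {x y : D}
    (hx : m • x = 0) (hy : n • y = 0) : q.polarBilin x y = 0 := by
  obtain ⟨r, s, hrs⟩ := hmn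
  have h1 : m • q.polarBilin x y = 0 := by
    rw [← LinearMap.smul_apply, ← map_smul, hx, map_zero, LinearMap.zero_apply]
  have h2 : n • q.polarBilin x y = 0 := by rw [← map_smul, hy, map_zero]
  rw [← one_smul ℤ (q.polarBilin x y), ← hrs, add_smul, mul_smul, mul_smul, h1, h2]
  simp

theorem isCompl_torsionBy {m n : ℤ} (hmn : IsCoprime m n) (h : ∀ x : D, (m * n) • x = 0) :
    IsCompl (Submodule.torsionBy ℤ D m) (Submodule.torsionBy ℤ D n) := by
  obtain ⟨r, s, hrs⟩ := hmn
  constructor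
  · rw [Submodule.disjoint_def]
    intro x hx hy
    rw [Submodule.mem_torsionBy_iff] at hx hy
    rw [← one_smul ℤ x, ← hrs, add_smul, mul_smul, mul_smul, hx, hy]
    simp
  · rw [Submodule.codisjoint_iff_exists_add_eq]
    intro x
    refine ⟨(s * n) • x, (r * m) • x, ?_, ?_, ?_⟩
    · rw [Submodule.mem_torsionBy_iff, smul_smul, show m * (s * n) = s * (m * n) by ring,
        mul_smul, h, smul_zero]
    · rw [Submodule.mem_torsionBy_iff, smul_smul, show n * (r * m) = r * (m * n) by ring,
        mul_smul, h, smul_zero]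
    · rw [← add_smul, add_comm, hrs, one_smul]

theorem comp_subtype_mem_forms {ι : Type*} [Fintype ι] [DecidableEq ι] (V : Submodule ℤ D)
    {G : (ι → D) → AddCircle (1 : ℚ)} (hG : G ∈ forms q ι) :
    (fun x : ι → V => G fun i => (x i : D)) ∈ forms (q.restrict V) ι := by
  obtain ⟨A, h1, h2⟩ := hG
  refine ⟨A, fun x y => ?_, fun i z => ?_⟩
  · have := h1 (fun i => (x i : D)) (fun i => (y i : D))
    simpa [Pi.add_def, QuadraticMap.polar] using this
  · have : (fun l => ((Pi.single i z : ι → V) l : D)) = Pi.single i (z : D) := by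
      ext l
      rcases eq_or_ne l i with rfl | h <;> simp [*]
    dsimp only
    rw [this, h2]
    rfl

/-- A multiplier congruent to `k` modulo `m ^ 2` and to 0 modulo `n ^ 2` turns the Gauss sum of `D`
into that of `V` times the nonzero real number `|W|`. Squares are needed because `m • x = 0` only
gives `m ^ 2 • q x = 0`. -/
theorem isSelfAdjoint_sum_restrict [Fintype D] {V W : Submodule ℤ D} [Fintype V] [Fintype W]
    (hVW : IsCompl V W) {m n : ℤ} (hmn : IsCoprime m n) (hV : ∀ x ∈ V, m • x = 0)
    (hW : ∀ x ∈ W, n • x = 0) (hτ : ∀ k : ℤ, IsSelfAdjoint (∑ z, expQZ (k • q z))) (k : ℤ) :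
    IsSelfAdjoint (∑ z : V, expQZ (k • q.restrict V z)) := by
  obtain ⟨r, s, hrs⟩ : IsCoprime (m ^ 2) (n ^ 2) := hmn.pow
  have h1 : ∑ z, expQZ ((k * (s * n ^ 2)) • q z) =
      (∑ z : V, expQZ (k • q.restrict V z)) * ∑ z : W, expQZ 0 := by
    refine sum_expQZ_eq_mul (Submodule.prodEquivOfIsCompl V W hVW).toEquiv _ _ _ ?_
    rintro ⟨x, y⟩
    have hx := sq_smul_eq_zero q (hV x x.2)
    have hy := sq_smul_eq_zero q (hW y y.2)
    have e : k * (s * n ^ 2) = k - k * r * m ^ 2 := by linear_combination k * hrs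
    change (k * (s * n ^ 2)) • q ((x : D) + y) = k • q x + 0
    rw [map_add_polarBilin, polarBilin_eq_zero_of_isCoprime q hmn (hV x x.2) (hW y y.2), add_zero,
      smul_add]
    congr 1
    · rw [e, sub_smul, mul_smul _ (m ^ 2), hx, smul_zero, sub_zero]
    · rw [← mul_assoc, mul_smul, hy, smul_zero]
  have h2 := hτ (k * (s * n ^ 2))
  rw [h1, expQZ_zero, Finset.sum_const, nsmul_one, Finset.card_univ] at h2
  have h3 : (Fintype.card W : ℂ) ≠ 0 := Nat.cast_ne_zero.2 Fintype.card_ne_zero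
  have h4 := h2.star_eq
  rw [star_mul', star_natCast] at h4
  exact mul_right_cancel₀ h3 h4

end

/-- The group varies in the induction on its exponent: a coprime factorisation splits `D` into
orthogonal torsion parts, and the sum into a product. -/
theorem isSelfAdjoint_sum_forms {ι : Type*} [Fintype ι] [DecidableEq ι] (N : ℕ) (hN : N ≠ 0) :
    ∀ {D : Type*} [AddCommGroup D] [Fintype D] (q : QuadraticMap ℤ D (AddCircle (1 : ℚ))),
      (∀ x : D, (N : ℤ) • x = 0) → (∀ k : ℤ, IsSelfAdjoint (∑ z, expQZ (k • q z))) →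
      ∀ G ∈ forms q ι, IsSelfAdjoint (∑ x, expQZ (G x)) := by
  classical
  induction N using Nat.recOnPrimeCoprime with
  | zero => exact absurd rfl hN
  | prime_pow p a hp =>
    intro D _ _ q hq hτ G hG
    have := isSelfAdjoint_sum_supported q hp (K := a) (by exact_mod_cast hq) hτ Finset.univ G hG
    have hsupp : supported D (Finset.univ : Finset ι) = Finset.univ := by
      ext x
      simp [mem_supported]
    rwa [hsupp] at this
  | coprime m n hm hn hmn ihm ihn =>
    intro D _ _ q hq hτ G hG
    have hcop : IsCoprime (m : ℤ) n := Nat.isCoprime_iff_coprime.2 hmn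
    have hc := isCompl_torsionBy (D := D) hcop (by exact_mod_cast hq)
    set V := Submodule.torsionBy ℤ D m
    set W := Submodule.torsionBy ℤ D n
    have hV : ∀ x ∈ V, (m : ℤ) • x = 0 := fun x hx => (Submodule.mem_torsionBy_iff _ _).1 hx
    have hW : ∀ x ∈ W, (n : ℤ) • x = 0 := fun x hx => (Submodule.mem_torsionBy_iff _ _).1 hx
    have h1 := ihm (by omega) (q.restrict V) (fun x => Subtype.ext (hV x x.2))
      (isSelfAdjoint_sum_restrict q hc hcop hV hW hτ) _ (comp_subtype_mem_forms q V hG)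
    have h2 := ihn (by omega) (q.restrict W) (fun x => Subtype.ext (hW x x.2))
      (isSelfAdjoint_sum_restrict q hc.symm hcop.symm hW hV hτ) _ (comp_subtype_mem_forms q W hG)
    obtain ⟨A, hA, -⟩ := hG
    rw [sum_expQZ_eq_mul ((Equiv.arrowProdEquivProdArrow ι (fun _ => V) (fun _ => W)).symm.trans
      (Equiv.piCongrRight fun _ => (Submodule.prodEquivOfIsCompl V W hc).toEquiv)) G
      (fun x => G fun i => (x i : D)) (fun x => G fun i => (x i : D)) ?_]
    · exact h1.mul h2
    · rintro ⟨x, y⟩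
      change G ((fun i => (x i : D)) + fun i => (y i : D)) = _
      rw [hA, Finset.sum_eq_zero, add_zero]
      intro i _
      refine Finset.sum_eq_zero fun j _ => ?_
      rw [polarBilin_eq_zero_of_isCoprime q hcop (hV _ (x i).2) (hW _ (y j).2), smul_zero]

/-! ### Both directions of the equivalence -/

section

variable {D : Type*} [AddCommGroup D] [Fintype D] (q : QuadraticMap ℤ D (AddCircle (1 : ℚ)))

theorem IsTInvariant.gaussSum_im {q : QuadraticMap ℤ D (AddCircle (1 : ℚ))} (h : IsTInvariant q)
    (n : ℕ) : (gaussSum q n).im = 0 := by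
  obtain ⟨f⟩ := h
  rw [← Complex.conj_eq_iff_im]
  change star (∑ x, expQZ (n • q x)) = ∑ x, expQZ (n • q x)
  rw [star_sum, ← f.toLinearEquiv.toEquiv.sum_comp]
  refine Finset.sum_congr rfl fun x _ => ?_
  have : (-q) (f x) = q x := f.map_app x
  change star (expQZ (n • q (f x))) = _
  rw [star_expQZ, ← smul_neg, ← this]
  rfl

theorem isSelfAdjoint_sum_of_gaussSum_im (h : ∀ n : ℕ, 1 ≤ n → (gaussSum q n).im = 0) (k : ℤ) :
    IsSelfAdjoint (∑ z, expQZ (k • q z)) := by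
  have hnat : ∀ n : ℕ, IsSelfAdjoint (∑ z, expQZ ((n : ℤ) • q z)) := by
    intro n
    rcases Nat.eq_zero_or_pos n with rfl | hn
    · simp [IsSelfAdjoint]
    · simp only [natCast_zsmul]
      exact Complex.conj_eq_iff_im.2 (h n hn)
  obtain ⟨n, rfl | rfl⟩ := k.eq_nat_or_neg
  · exact hnat n
  · have := (hnat n).star_eq
    simp only [star_sum, star_expQZ] at this
    simp only [neg_smul, this]
    exact hnat n

/-- A map reversing the sign of a nondegenerate form and of its bilinear form is an isometry. -/
theorem isTInvariant_of_map {q : QuadraticMap ℤ D (AddCircle (1 : ℚ))} (hq : Nondegenerate q)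
    (f : D → D) (hf : ∀ x, q (f x) = -q x)
    (hf' : ∀ x y, q.polarBilin (f x) (f y) = -q.polarBilin x y) : IsTInvariant q := by
  have hinj : Function.Injective f := by
    intro x y hxy
    rw [← sub_eq_zero]
    refine hq.1 _ fun z => ?_
    rw [map_sub, LinearMap.sub_apply, sub_eq_zero, ← neg_inj, ← hf', ← hf', hxy]
  have hbij : Function.Bijective f := hinj.bijective_of_finite
  have hadd : ∀ x y, f (x + y) = f x + f y := by
    intro x y
    rw [← sub_eq_zero]
    refine hq.1 _ fun w => ?_
    obtain ⟨z, rfl⟩ := hbij.2 w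
    simp only [map_sub, map_add, LinearMap.sub_apply, LinearMap.add_apply, hf']
    abel
  let g : D ≃+ D := { Equiv.ofBijective f hbij with map_add' := hadd }
  exact ⟨{ g.toIntLinearEquiv with
    map_app' := fun x => by
      change -q (f x) = q x
      rw [hf, neg_neg] }⟩

theorem isTInvariant_of_gaussSum_im {q : QuadraticMap ℤ D (AddCircle (1 : ℚ))}
    (hq : Nondegenerate q) (h : ∀ n : ℕ, 1 ≤ n → (gaussSum q n).im = 0) : IsTInvariant q := by
  classical
  have hcard : ∀ x : D, (Fintype.card D : ℤ) • x = 0 := fun x => by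
    rw [natCast_zsmul, card_nsmul_eq_zero]
  let Φ : (D → D) → D ⊕ D × D → AddCircle (1 : ℚ) := fun f =>
    Sum.elim (fun x => q (f x)) (fun w => q.polarBilin (f w.1) (f w.2))
  have hΦ : ∀ f k, (Fintype.card D ^ 2) • Φ f k = 0 := by
    have h1 : ∀ x, (Fintype.card D ^ 2) • q x = 0 := fun x => by
      exact_mod_cast sq_smul_eq_zero q (hcard x)
    rintro f (x | ⟨x, y⟩)
    · exact h1 _
    · change (Fintype.card D ^ 2) • q.polarBilin (f x) (f y) = 0
      rw [eq_sub_of_add_eq' (map_add_polarBilin q (f x) (f y)).symm, smul_sub, smul_add, h1, h1, h1]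
      simp
  have hmem : ∀ n : D ⊕ D × D → ℕ, (fun f => ∑ k, n k • Φ f k) ∈ forms q D := by
    intro n
    have : (fun f => ∑ k, n k • Φ f k) = ∑ k, fun f => n k • Φ f k := by
      ext f
      simp
    rw [this]
    refine sum_mem fun k _ => ?_
    have hs : ∀ (x : D) (f : D → D), linComb (Pi.single x 1) f = f x := fun x f => by
      rw [linComb, Finset.sum_eq_single x] <;> simp +contextual
    rcases k with x | ⟨x, y⟩
    · change (fun f : D → D => n (Sum.inl x) • q (f x)) ∈ forms q D
      simpa only [hs, natCast_zsmul] using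
        smul_map_linComb_mem_forms q (n (Sum.inl x) : ℤ) (Pi.single x 1)
    · change (fun f : D → D => n (Sum.inr (x, y)) • q.polarBilin (f x) (f y)) ∈ forms q D
      simpa only [hs, natCast_zsmul] using
        smul_polarBilin_linComb_mem_forms q (n (Sum.inr (x, y)) : ℤ) (Pi.single x 1)
          (Pi.single y 1)
  -- The family attained by `id` consists of the values of `q` and `b` themselves; any `f` attaining
  -- its negative reverses both.
  obtain ⟨f, hf⟩ := exists_eq_neg_of_isSelfAdjoint (pow_ne_zero 2 Fintype.card_ne_zero) Φ hΦ
    (fun n => isSelfAdjoint_sum_forms (Fintype.card D) Fintype.card_ne_zero q hcard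
      (isSelfAdjoint_sum_of_gaussSum_im q h) _ (hmem n)) id
  exact isTInvariant_of_map hq f (fun x => congrFun hf (Sum.inl x))
    (fun x y => congrFun hf (Sum.inr (x, y)))

end

end FiniteQuadraticForm

theorem theorem3 {D : Type*} [AddCommGroup D] [Fintype D]
    (q : QuadraticMap ℤ D (AddCircle (1 : ℚ))) (hq : FiniteQuadraticForm.Nondegenerate q) :
    FiniteQuadraticForm.IsTInvariant q ↔
      ∀ n : ℕ, 1 ≤ n → (FiniteQuadraticForm.gaussSum q n).im = 0 :=
  ⟨fun h n _ => h.gaussSum_im n, FiniteQuadraticForm.isTInvariant_of_gaussSum_im hq⟩
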